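/- Let $n$ be a positive integer and let $K_n$ be the complete graph on the vertices $v_1,\dots,v_n$. Suppose that the edge set of $K_n$ is partitioned into three (possibly empty) pairwise disjoint classes $S$, $T$, $Z$ with $|Z| = n-3$ (so that $n \ge 3$). For each $i$ let $s_i$, $t_i$, $z_i$ denote the degrees of the vertex $v_i$ in $S$, $T$, $Z$, respectively, that is, the number of edges of that class incident with $v_i$. Then $$\sum_{i=1}^n s_i t_i \;\ge\; \min\Bigl\{\sum_{i=1}^n z_i t_i,\ \sum_{i=1}^n z_i s_i\Bigr\}.$$ -/

import Mathlib

/-- `S`, `T`, `Z` form a partition of the edge set of the complete graph on `Fin n`: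
every set consists of edges (two-element subsets of the vertex set), the three sets
are pairwise disjoint, and together they cover all edges. Empty classes are allowed. -/
structure IsEdgePartition {n : ℕ} (S T Z : Finset (Sym2 (Fin n))) : Prop where
  disjoint_ST : Disjoint S T
  disjoint_SZ : Disjoint S Z
  disjoint_TZ : Disjoint T Z
  union_eq : S ∪ T ∪ Z = (⊤ : SimpleGraph (Fin n)).edgeFinset

/-- The degree of the vertex `v` in the edge set `A`: the number of edges of `A`
incident with `v`. -/
def edgeSetDegree {n : ℕ} (A : Finset (Sym2 (Fin n))) (v : Fin n) : ℕ :=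
  (A.filter (fun e => v ∈ e)).card

/-! By the symmetry between `S` and `T`, assume |T| ≤ |S| and compare with the sum of z·t. Put N = n
- 1. Since s = N - t - z at every vertex, the difference of the two sums is the sum of t(N - 2z -
t), which is `cherryGap`. It must be shown nonnegative when Z has N - 2 edges and m = |T| is at most
half the number of edges outside Z.

For m ≤ 3, distribute the gap over the edges of T: each contributes at least 2N - 2(N - 2) - (m + 1)
= 3 - m. For large m, de Caen's bound on the sum of squared degrees, applied to T ∪ Z, gives a gap
above -2; the gap is even, so it is nonnegative (`cherryGap_nonneg_of_deCaen`).

The range m ≤ N + 2 is handled by induction on N (`cherryGap_nonneg`), deleting one vertex and one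
edge of Z. If Z has a leaf, delete it (`cherryGap_nonneg_of_leaf`). Otherwise Z, having average
degree below 2, has an isolated vertex; delete it and also drop from Z an edge whose ends have small
total T-degree (`cherryGap_nonneg_of_isolated`). The extremal value m = N + 2 is again within reach
of de Caen's bound once N > 6; the cases N = 4, 5, 6 combine both methods. -/

/-- `T` is the `0`/`1` adjacency function of a simple graph. -/
structure IsAdjacency {α : Type*} (T : α → α → ℤ) : Prop where
  symm : ∀ u v, T u v = T v u
  irrefl : ∀ u, T u u = 0
  zero_or_one : ∀ u v, T u v = 0 ∨ T u v = 1

/-- The degree of `v` in the graph `T` restricted to `W`. -/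
def degOn {α : Type*} (T : α → α → ℤ) (W : Finset α) (v : α) : ℤ := ∑ u ∈ W, T v u

/-- For disjoint graphs `T`, `Z` on `W`, the number of pairs of adjacent edges of which one is in
`T` and one in the complement of `T ∪ Z`, minus the number of those with one in `T` and one
in `Z`. -/
def cherryGap {α : Type*} (T Z : α → α → ℤ) (W : Finset α) : ℤ :=
  ∑ v ∈ W, degOn T W v * ((W.card : ℤ) - 1 - 2 * degOn Z W v - degOn T W v)

/-! ### Degree sums, parity, de Caen's bound, and graphs `T` with few edges -/

section

variable {α : Type*} {T Z : α → α → ℤ} {W : Finset α}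

theorem IsAdjacency.nonneg (hT : IsAdjacency T) (u v : α) : 0 ≤ T u v := by
  rcases hT.zero_or_one u v with h | h <;> omega

theorem IsAdjacency.le_one (hT : IsAdjacency T) (u v : α) : T u v ≤ 1 := by
  rcases hT.zero_or_one u v with h | h <;> omega

theorem IsAdjacency.sq (hT : IsAdjacency T) (u v : α) : T u v * T u v = T u v := by
  rcases hT.zero_or_one u v with h | h <;> simp [h]

theorem IsAdjacency.ne_of_adj (hT : IsAdjacency T) {x y : α} (h : T x y = 1) : x ≠ y := fun e => by
  rw [e, hT.irrefl] at h; omega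

theorem IsAdjacency.degOn_nonneg (hT : IsAdjacency T) (v : α) : 0 ≤ degOn T W v :=
  Finset.sum_nonneg fun u _ => hT.nonneg v u

theorem IsAdjacency.add (hT : IsAdjacency T) (hZ : IsAdjacency Z)
    (hd : ∀ u v, T u v + Z u v ≤ 1) : IsAdjacency fun u v => T u v + Z u v where
  symm u v := by rw [hT.symm u v, hZ.symm u v]
  irrefl u := by rw [hT.irrefl u, hZ.irrefl u]; rfl
  zero_or_one u v := by
    have h := hd u v
    rcases hT.zero_or_one u v with h1 | h1 <;> rcases hZ.zero_or_one u v with h2 | h2 <;>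
      simp [h1, h2] at h ⊢

theorem degOn_add (v : α) : degOn (fun u v => T u v + Z u v) W v = degOn T W v + degOn Z W v :=
  Finset.sum_add_distrib

theorem two_mul_sum_mul_degOn (hT : IsAdjacency T) (w : α → ℤ) :
    2 * ∑ u ∈ W, w u * degOn T W u = ∑ u ∈ W, ∑ v ∈ W, T u v * (w u + w v) := by
  have h1 : ∑ u ∈ W, w u * degOn T W u = ∑ u ∈ W, ∑ v ∈ W, T u v * w u := by
    refine Finset.sum_congr rfl fun u _ => ?_
    rw [degOn, Finset.mul_sum]
    exact Finset.sum_congr rfl fun v _ => mul_comm _ _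
  have h2 : ∑ u ∈ W, w u * degOn T W u = ∑ u ∈ W, ∑ v ∈ W, T u v * w v := by
    rw [h1, Finset.sum_comm]
    exact Finset.sum_congr rfl fun u _ => Finset.sum_congr rfl fun v _ => by rw [hT.symm]
  simp only [mul_add, Finset.sum_add_distrib]
  rw [← h1, ← h2]; ring

/-- A bound for weighted sums of degrees by edges counted with the excess of their weight. -/
theorem sum_mul_degOn_add_le (hT : IsAdjacency T) (hZ : IsAdjacency Z) {r q B : ℤ} (w w' : α → ℤ)
    (b : α → α → ℤ)
    (hr : ∑ v ∈ W, degOn T W v = 2 * r) (hq : ∑ v ∈ W, degOn Z W v = 2 * q)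
    (hb : ∀ u ∈ W, ∀ v ∈ W, T u v * (w u + w v) + Z u v * (w' u + w' v) ≤ T u v + Z u v + b u v)
    (hB : ∑ u ∈ W, ∑ v ∈ W, b u v = 2 * B) :
    ∑ v ∈ W, w v * degOn T W v + ∑ v ∈ W, w' v * degOn Z W v ≤ r + q + B := by
  have h1 := two_mul_sum_mul_degOn (W := W) hT w
  have h2 := two_mul_sum_mul_degOn (W := W) hZ w'
  have h3 : ∑ u ∈ W, ∑ v ∈ W, (T u v * (w u + w v) + Z u v * (w' u + w' v))
      ≤ ∑ u ∈ W, ∑ v ∈ W, (T u v + Z u v + b u v) :=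
    Finset.sum_le_sum fun u hu => Finset.sum_le_sum fun v hv => hb u hu v hv
  simp only [Finset.sum_add_distrib, hB] at h3
  have h4 : ∑ u ∈ W, ∑ v ∈ W, T u v = 2 * r := hr
  have h5 : ∑ u ∈ W, ∑ v ∈ W, Z u v = 2 * q := hq
  linarith

theorem IsAdjacency.degOn_le [DecidableEq α] (hT : IsAdjacency T) {v : α} (hv : v ∈ W) :
    degOn T W v ≤ W.card - 1 := by
  have h : degOn T W v ≤ ∑ u ∈ W, (1 - if u = v then 1 else 0) := by
    refine Finset.sum_le_sum fun u _ => ?_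
    by_cases h : u = v
    · simp [h, hT.irrefl]
    · simpa [h] using hT.le_one v u
  simpa [Finset.sum_sub_distrib, hv] using h

/-- Modulo 2 each vertex term reduces to t(t - 1) plus a multiple of the degree t, and the degrees
sum to an even number. Parity makes every strict lower bound by -2 sufficient. -/
theorem even_cherryGap (m : ℤ) (hm : ∑ v ∈ W, degOn T W v = 2 * m) : Even (cherryGap T Z W) := by
  have h : cherryGap T Z W = 2 * m * (W.card - 1) - 2 * m
      - ∑ v ∈ W, (2 * (degOn T W v * degOn Z W v) + degOn T W v * (degOn T W v - 1)) := by
    rw [← hm, cherryGap, Finset.sum_mul, ← Finset.sum_sub_distrib, ← Finset.sum_sub_distrib]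
    exact Finset.sum_congr rfl fun v _ => by ring
  rw [h]
  refine ((Even.sub (by simp [mul_assoc]) (by simp))).sub ?_
  refine Finset.even_sum _ fun v _ => (even_two_mul _).add (Int.even_mul_pred_self _)

/-- The squares of the degrees of a graph with `σ / 2` edges satisfy de Caen's bound. -/
theorem deCaen [DecidableEq α] (hT : IsAdjacency T) {N σ : ℤ} (hW : (W.card : ℤ) = N + 1)
    (hσ : ∑ v ∈ W, degOn T W v = σ) :
    2 * N * ∑ v ∈ W, degOn T W v ^ 2 ≤ σ * (σ + N * (N - 1)) := by
  -- A local form of the bound: summing it over v turns the left side into N times the sum of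
  -- squared degrees, and the same sum appears negated on the right.
  have key : ∀ v ∈ W, N * ∑ u ∈ W, T v u * degOn T W u
      ≤ degOn T W v * (σ + N * (N - 1) - N * degOn T W v) := by
    intro v hv
    set d := degOn T W v with hd
    have hd0 : 0 ≤ d := hT.degOn_nonneg v
    have hdN : d ≤ N := by have := hT.degOn_le hv; omega
    -- `o` indicates the non-neighbours of v other than v itself, so `E` below counts the edges
    -- between neighbours and non-neighbours, and `X` is the sum of the degrees of the neighbours.
    set o : α → ℤ := fun u => 1 - T v u - if u = v then 1 else 0 with ho
    have ho0 : ∀ u, 0 ≤ o u := by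
      intro u
      by_cases h : u = v
      · simp [ho, h, hT.irrefl]
      · have := hT.le_one v u
        simp [ho, h, this]
    have ho1 : ∀ u, o u ≤ 1 := by
      intro u
      have := hT.nonneg v u
      simp only [ho]; split_ifs <;> omega
    have hosum : ∑ u ∈ W, o u = N - d := by
      simp only [ho, Finset.sum_sub_distrib, Finset.sum_const, Finset.sum_ite_eq', hv, if_true, hd,
        degOn, nsmul_eq_mul, hW]
      ring
    set E := ∑ u ∈ W, ∑ w ∈ W, T v u * o w * T u w with hE
    set X := ∑ u ∈ W, T v u * degOn T W u with hX
    have hEle : E ≤ d * (N - d) := by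
      rw [← hosum, hd, degOn, Finset.sum_mul_sum]
      refine Finset.sum_le_sum fun u _ => Finset.sum_le_sum fun w _ => ?_
      exact mul_le_of_le_one_right (mul_nonneg (hT.nonneg _ _) (ho0 _)) (hT.le_one _ _)
    have hE0 : 0 ≤ E := Finset.sum_nonneg fun u _ => Finset.sum_nonneg fun w _ =>
      mul_nonneg (mul_nonneg (hT.nonneg _ _) (ho0 _)) (hT.nonneg _ _)
    have hXE : X = d + (∑ u ∈ W, ∑ w ∈ W, T v u * T v w * T u w) + E := by
      rw [hE, hX, hd, degOn, ← Finset.sum_add_distrib, ← Finset.sum_add_distrib]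
      refine Finset.sum_congr rfl fun u _ => ?_
      have : T v u = ∑ w ∈ W, T v u * (if w = v then 1 else 0) * T u w := by
        simp [Finset.sum_ite_eq', hv, ite_mul, hT.symm u v, hT.sq]
      conv_rhs => rw [this]
      rw [degOn, Finset.mul_sum, ← Finset.sum_add_distrib, ← Finset.sum_add_distrib]
      refine Finset.sum_congr rfl fun w _ => ?_
      rw [← this]
      simp only [ho]; ring
    have hI : ∑ u ∈ W, ∑ w ∈ W, T v u * T v w * T u w ≤ d * d - d := by
      have h1 : d * d - d = ∑ u ∈ W, ∑ w ∈ W, (T v u * T v w - if w = u then T v u else 0) := by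
        simp only [Finset.sum_sub_distrib, Finset.sum_ite_eq']
        rw [hd, degOn, Finset.sum_mul_sum]
        congr 1
        exact Finset.sum_congr rfl fun u hu => by simp [hu]
      rw [h1]
      refine Finset.sum_le_sum fun u _ => Finset.sum_le_sum fun w _ => ?_
      by_cases h : w = u
      · simp [h, hT.irrefl, hT.sq]
      · simpa [h] using
          mul_le_of_le_one_right (mul_nonneg (hT.nonneg _ _) (hT.nonneg _ _)) (hT.le_one u w)
    have hY : d + X + E ≤ σ := by
      have h1 : σ = d + X + ∑ u ∈ W, o u * degOn T W u := by
        have h2 : d = ∑ u ∈ W, (if u = v then 1 else 0) * degOn T W u := by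
          simp [ite_mul, hv, hd]
        rw [h2, hX, ← hσ, ← Finset.sum_add_distrib, ← Finset.sum_add_distrib]
        refine Finset.sum_congr rfl fun u _ => ?_
        simp only [ho]; ring
      rw [h1]
      gcongr
      rw [hE, Finset.sum_comm]
      refine Finset.sum_le_sum fun w _ => ?_
      rw [degOn, Finset.mul_sum]
      refine Finset.sum_le_sum fun u _ => ?_
      rw [hT.symm u w, mul_assoc]
      exact mul_le_of_le_one_left (mul_nonneg (ho0 _) (hT.nonneg _ _)) (hT.le_one _ _)
    have hXle : X ≤ d * d + E := by linarith
    have h3 : (N - 2 * d) * E ≤ d * (N - d) * (N - 1 - d) := by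
      rcases le_total (2 * d) N with h | h
      · rcases hd0.eq_or_lt with h0 | h0
        · rw [← h0] at hEle ⊢
          have : E = 0 := by linarith
          simp [this]
        · calc (N - 2 * d) * E ≤ (N - 2 * d) * (d * (N - d)) := by
                apply mul_le_mul_of_nonneg_left hEle; linarith
            _ ≤ d * (N - d) * (N - 1 - d) := by
                rw [mul_comm]
                apply mul_le_mul_of_nonneg_left (by linarith)
                exact mul_nonneg hd0 (by linarith)
      · rcases hdN.eq_or_lt with h0 | h0
        · have : E = 0 := by rw [h0] at hEle; linarith
          rw [this, h0]; simp
        · calc (N - 2 * d) * E ≤ 0 := mul_nonpos_of_nonpos_of_nonneg (by linarith) hE0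
            _ ≤ _ := mul_nonneg (mul_nonneg hd0 (by linarith)) (by linarith)
    have h4 : (N - d) * X ≤ (N - d) * (d * d + E) :=
      mul_le_mul_of_nonneg_left hXle (by linarith)
    have h5 : d * (d + X + E) ≤ d * σ := mul_le_mul_of_nonneg_left hY hd0
    -- Write N·X = (N - d)·X + d·X and apply `h4` and `h5` to the two parts; `h3` absorbs the
    -- remaining (N - 2d)·E exactly.
    nlinarith
  have h1 := Finset.sum_le_sum key
  have h2 : ∑ v ∈ W, N * ∑ u ∈ W, T v u * degOn T W u = N * ∑ v ∈ W, degOn T W v ^ 2 := by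
    rw [← Finset.mul_sum, Finset.sum_comm]
    congr 1
    refine Finset.sum_congr rfl fun u _ => ?_
    rw [← Finset.sum_mul, sq]
    congr 1
    exact Finset.sum_congr rfl fun v _ => hT.symm v u
  have h3 : ∑ v ∈ W, degOn T W v * (σ + N * (N - 1) - N * degOn T W v)
      = σ * (σ + N * (N - 1)) - N * ∑ v ∈ W, degOn T W v ^ 2 := by
    nth_rw 2 [← hσ]
    rw [Finset.sum_mul, Finset.mul_sum, ← Finset.sum_sub_distrib]
    exact Finset.sum_congr rfl fun v _ => by ring
  rw [h2, h3] at h1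
  linarith

/-- De Caen's bound for the union of `T` and `Z`, as a lower bound for the cherry gap. -/
theorem deCaen_cherryGap [DecidableEq α] (hT : IsAdjacency T) (hZ : IsAdjacency Z)
    (hd : ∀ u v, T u v + Z u v ≤ 1) {N m q : ℤ} (hW : (W.card : ℤ) = N + 1)
    (hm : ∑ v ∈ W, degOn T W v = 2 * m) (hq : ∑ v ∈ W, degOn Z W v = 2 * q) :
    2 * (m + q) * (N * (N + 1) - 2 * (m + q)) - 4 * N ^ 2 * q + 2 * N * ∑ v ∈ W, degOn Z W v ^ 2
      ≤ 2 * N * cherryGap T Z W := by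
  have h := deCaen (hT.add hZ hd) hW (σ := 2 * (m + q)) (by
    simp only [degOn_add, Finset.sum_add_distrib, hm, hq]; ring)
  simp only [degOn_add] at h
  have h1 : cherryGap T Z W = N * (2 * (m + q)) - ∑ v ∈ W, (degOn T W v + degOn Z W v) ^ 2
      - N * (2 * q) + ∑ v ∈ W, degOn Z W v ^ 2 := by
    rw [mul_add 2, ← hm, ← hq, ← Finset.sum_add_distrib, Finset.mul_sum, Finset.mul_sum,
      ← Finset.sum_sub_distrib, ← Finset.sum_sub_distrib, ← Finset.sum_add_distrib, cherryGap, hW]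
    exact Finset.sum_congr rfl fun v _ => by ring
  rw [h1]
  linarith

/-- Integrality of the Z-degrees gives (z - 1)(z - 2) ≥ 0, hence a better lower bound on the sum of
z² than convexity alone. Inserted into de Caen's bound, the numerical hypothesis is exactly what
pushes the gap above -2, and parity does the rest. -/
theorem cherryGap_nonneg_of_deCaen [DecidableEq α] (hT : IsAdjacency T) (hZ : IsAdjacency Z)
    (hd : ∀ u v, T u v + Z u v ≤ 1) {N m : ℤ} (hW : (W.card : ℤ) = N + 1) (hN : 0 < N)
    (hm : ∑ v ∈ W, degOn T W v = 2 * m) (hq : ∑ v ∈ W, degOn Z W v = 2 * (N - 2))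
    (h : N * (2 * N ^ 2 - 8 * N + 12) < (m + N - 2) * (N * (N + 1) - 2 * (m + N - 2))) :
    0 ≤ cherryGap T Z W := by
  have h1 := deCaen_cherryGap hT hZ hd hW hm hq
  have h2 : 4 * N - 14 ≤ ∑ v ∈ W, degOn Z W v ^ 2 := by
    have h3 : 0 ≤ ∑ v ∈ W, (degOn Z W v - 1) * (degOn Z W v - 2) := by
      refine Finset.sum_nonneg fun v _ => ?_
      rcases le_or_gt (degOn Z W v) 1 with h | h
      · exact mul_nonneg_of_nonpos_of_nonpos (by linarith) (by linarith)
      · exact mul_nonneg (by linarith) (by linarith [Int.add_one_le_iff.mpr h])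
    have h4 : ∑ v ∈ W, (degOn Z W v - 1) * (degOn Z W v - 2)
        = ∑ v ∈ W, degOn Z W v ^ 2 - 3 * (2 * (N - 2)) + 2 * (N + 1) := by
      rw [← hq, ← hW, Finset.mul_sum, ← Finset.sum_sub_distrib]
      have : (2 * (W.card : ℤ)) = ∑ v ∈ W, 2 := by simp [mul_comm]
      rw [this, ← Finset.sum_add_distrib]
      exact Finset.sum_congr rfl fun v _ => by ring
    linarith
  have h5 : -2 < cherryGap T Z W := by
    have h6 : 2 * N * (4 * N - 14) ≤ 2 * N * ∑ v ∈ W, degOn Z W v ^ 2 :=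
      mul_le_mul_of_nonneg_left h2 (by linarith)
    have h7 : 2 * N * (-2) < 2 * N * cherryGap T Z W := by
      refine lt_of_lt_of_le ?_ h1
      nlinarith
    exact lt_of_mul_lt_mul_left h7 (by linarith)
  obtain ⟨k, hk⟩ := even_cherryGap (Z := Z) m hm
  omega

/-- Only the edge xy can be counted at both x and y. -/
theorem degOn_add_degOn_le [DecidableEq α] (hT : IsAdjacency T) {m : ℤ} {x y : α} (hx : x ∈ W)
    (hy : y ∈ W) (hxy : x ≠ y) (hm : ∑ v ∈ W, degOn T W v = 2 * m) :
    degOn T W x + degOn T W y ≤ m + T x y := by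
  have h := two_mul_sum_mul_degOn (W := W) hT
    (fun u => (if u = x then 1 else 0) + (if u = y then 1 else 0))
  have h1 : ∑ u ∈ W, ∑ v ∈ W, T u v * (((if u = x then 1 else 0) + (if u = y then 1 else 0)) +
      ((if v = x then 1 else 0) + (if v = y then 1 else 0))) ≤
      ∑ u ∈ W, ∑ v ∈ W, (T u v + (if u = x then 1 else 0) * (if v = y then 1 else 0) * T x y
        + (if u = y then 1 else 0) * (if v = x then 1 else 0) * T x y) := by
    refine Finset.sum_le_sum fun u _ => Finset.sum_le_sum fun v _ => ?_
    have h0 := hT.nonneg u v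
    have h2 := hT.nonneg x y
    have := hT.symm x y
    have := hT.irrefl x
    have := hT.irrefl y
    split_ifs <;> subst_vars <;> simp_all <;> linarith
  have h2 : ∑ u ∈ W, ∑ v ∈ W, (T u v + (if u = x then 1 else 0) * (if v = y then 1 else 0) * T x y
        + (if u = y then 1 else 0) * (if v = x then 1 else 0) * T x y) = 2 * m + 2 * T x y := by
    simp only [Finset.sum_add_distrib, ← Finset.sum_mul, ← Finset.mul_sum]
    simp [hx, hy, ← hm, degOn]
    ring
  simp only [add_mul, ite_mul, one_mul, zero_mul, Finset.sum_add_distrib, Finset.sum_ite_eq', hx, hy,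
    if_true] at h
  rw [h2] at h1
  linarith

/-- The cherry gap is nonnegative if `T` has at most three edges. -/
theorem cherryGap_nonneg_of_le_three [DecidableEq α] (hT : IsAdjacency T) (hZ : IsAdjacency Z)
    (hd : ∀ u v, T u v + Z u v ≤ 1) {N m : ℤ} (hW : (W.card : ℤ) = N + 1)
    (hm : ∑ v ∈ W, degOn T W v = 2 * m) (hq : ∑ v ∈ W, degOn Z W v = 2 * (N - 2))
    (hm3 : m ≤ 3) : 0 ≤ cherryGap T Z W := by
  have h := two_mul_sum_mul_degOn (W := W) hT (fun v => N - 2 * degOn Z W v - degOn T W v)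
  have h1 : ∑ v ∈ W, (N - 2 * degOn Z W v - degOn T W v) * degOn T W v = cherryGap T Z W := by
    rw [cherryGap, hW]
    exact Finset.sum_congr rfl fun v _ => by ring
  rw [h1] at h
  suffices 0 ≤ 2 * cherryGap T Z W by linarith
  rw [h]
  refine Finset.sum_nonneg fun u hu => Finset.sum_nonneg fun v hv => ?_
  rcases hT.zero_or_one u v with h0 | h0
  · simp [h0]
  · have huv : u ≠ v := fun h => by rw [h, hT.irrefl] at h0; omega
    have h2 := degOn_add_degOn_le hT hu hv huv hm
    have h3 := degOn_add_degOn_le hZ hu hv huv hq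
    have h4 := hd u v
    rw [h0]
    linarith

end

/-! ### Deleting a vertex, and the case of a leaf of `Z` -/

section

variable {α : Type*} [DecidableEq α] {T Z : α → α → ℤ} {W : Finset α} {a : α}

theorem degOn_eq_add_erase (ha : a ∈ W) (v : α) :
    degOn T W v = T v a + degOn T (W.erase a) v :=
  (Finset.add_sum_erase W (T v) ha).symm

theorem degOn_erase_self (hT : IsAdjacency T) (ha : a ∈ W) :
    degOn T (W.erase a) a = degOn T W a := by
  rw [degOn_eq_add_erase ha, hT.irrefl, zero_add]

theorem sum_degOn_erase (hT : IsAdjacency T) (ha : a ∈ W) :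
    ∑ v ∈ W.erase a, degOn T (W.erase a) v = ∑ v ∈ W, degOn T W v - 2 * degOn T W a := by
  rw [← Finset.add_sum_erase W _ ha]
  simp only [degOn_eq_add_erase (W := W) ha, Finset.sum_add_distrib, hT.irrefl]
  have : ∑ v ∈ W.erase a, T v a = degOn T (W.erase a) a :=
    Finset.sum_congr rfl fun v _ => hT.symm v a
  rw [this]; ring

theorem sum_adj_erase (hT : IsAdjacency T) (ha : a ∈ W) :
    ∑ v ∈ W.erase a, T a v = degOn T W a := degOn_erase_self hT ha

/-- The bookkeeping of the induction: the remaining vertices lose 1 from N and regain their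
adjacencies to `a`, and the last term collects what `a` contributes, directly and through its
neighbours. Disjointness of T and Z removes the mixed products. -/
theorem cherryGap_eq_erase (hT : IsAdjacency T) (hZ : IsAdjacency Z)
    (hd : ∀ u v, T u v + Z u v ≤ 1) (ha : a ∈ W) {N r : ℤ} (hW : (W.card : ℤ) = N + 1)
    (hr : ∑ v ∈ W.erase a, degOn T (W.erase a) v = 2 * r) :
    cherryGap T Z W = cherryGap T Z (W.erase a) + 2 * r
      - 2 * ∑ v ∈ W.erase a, Z a v * degOn T (W.erase a) v
      - 2 * ∑ v ∈ W.erase a, T a v * (degOn T (W.erase a) v + degOn Z (W.erase a) v)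
      + degOn T W a * (2 * N - 1 - 2 * degOn Z W a - degOn T W a) := by
  have hW' : ((W.erase a).card : ℤ) = N := by
    rw [Finset.card_erase_of_mem ha]
    have := Finset.card_pos.mpr ⟨a, ha⟩
    omega
  have h1 : degOn T W a * (2 * N - 1 - 2 * degOn Z W a - degOn T W a)
      = (N - 1) * ∑ v ∈ W.erase a, T a v
        + degOn T W a * (N - 2 * degOn Z W a - degOn T W a) := by
    rw [sum_adj_erase hT ha]; ring
  rw [cherryGap, ← Finset.add_sum_erase W _ ha, cherryGap, ← hr, h1, Finset.mul_sum,
    Finset.mul_sum, Finset.mul_sum, hW, hW']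
  have h2 : ∀ x y z w A B : ℤ, A + x - y - z + (w + B) = B + (A + x - y - z + w) := by
    intros; ring
  rw [h2, ← Finset.sum_add_distrib, ← Finset.sum_sub_distrib, ← Finset.sum_sub_distrib,
    ← Finset.sum_add_distrib]
  congr 1
  · ring
  refine Finset.sum_congr rfl fun v _ => ?_
  rw [degOn_eq_add_erase ha, degOn_eq_add_erase ha, hT.symm v a, hZ.symm v a]
  have h3 := hd a v
  rcases hT.zero_or_one a v with h | h <;> rcases hZ.zero_or_one a v with h' | h' <;>
    simp only [h, h'] at h3 ⊢ <;> first | omega | ring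

theorem sum_offDiag_mul (hT : IsAdjacency T) (ha : a ∈ W) :
    ∑ u ∈ W.erase a, ∑ v ∈ W.erase a, (T a u * T a v - if v = u then T a u else 0)
      = degOn T W a * (degOn T W a - 1) := by
  simp only [Finset.sum_sub_distrib, Finset.sum_ite_eq']
  rw [← Finset.sum_mul_sum, sum_adj_erase hT ha, mul_sub, mul_one]
  congr 1
  rw [← sum_adj_erase hT ha]
  exact Finset.sum_congr rfl fun u hu => if_pos hu

/-- The degrees at the neighbours of `a`: edges between neighbours are counted twice. -/
theorem two_mul_sum_neighbor_degOn_le (hT : IsAdjacency T) (hZ : IsAdjacency Z)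
    (hd : ∀ u v, T u v + Z u v ≤ 1) (ha : a ∈ W) {r q : ℤ}
    (hr : ∑ v ∈ W.erase a, degOn T (W.erase a) v = 2 * r)
    (hq : ∑ v ∈ W.erase a, degOn Z (W.erase a) v = 2 * q) :
    2 * ∑ v ∈ W.erase a, T a v * (degOn T (W.erase a) v + degOn Z (W.erase a) v)
      ≤ 2 * (r + q) + degOn T W a * (degOn T W a - 1) := by
  obtain ⟨k, hk⟩ := Int.even_mul_pred_self (degOn T W a)
  have h := sum_mul_degOn_add_le hT hZ (fun v => T a v) (fun v => T a v)
    (fun u v => T a u * T a v - if v = u then T a u else 0) (B := k) hr hq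
    (fun u _ v _ => by
      by_cases huv : v = u
      · simp [huv, hT.irrefl, hZ.irrefl, hT.sq]
      · have h3 := hd u v
        simp only [huv, if_false]
        rcases hT.zero_or_one u v with h1 | h1 <;> rcases hZ.zero_or_one u v with h2 | h2 <;>
          rcases hT.zero_or_one a u with h4 | h4 <;> rcases hT.zero_or_one a v with h5 | h5 <;>
          simp [h1, h2, h4, h5] at h3 ⊢)
    (by rw [sum_offDiag_mul hT ha, hk]; ring)
  simp only [mul_add, Finset.sum_add_distrib]
  linarith

theorem exists_unique_neighbor (hZ : IsAdjacency Z) (hz : degOn Z W a = 1) :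
    ∃ y ∈ W, ∀ v ∈ W, Z a v = if v = y then 1 else 0 := by
  obtain ⟨y, hy, hy1⟩ : ∃ y ∈ W, Z a y = 1 := by
    by_contra! h
    have : degOn Z W a = 0 := Finset.sum_eq_zero fun v hv =>
      (hZ.zero_or_one a v).resolve_right (h v hv)
    omega
  refine ⟨y, hy, fun v hv => ?_⟩
  by_cases hvy : v = y
  · simp [hvy, hy1]
  · rw [if_neg hvy]
    rw [degOn_eq_add_erase hy, hy1] at hz
    have h1 := Finset.single_le_sum (f := Z a) (fun u _ => hZ.nonneg a u)
      (Finset.mem_erase.mpr ⟨hvy, hv⟩)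
    have h2 := hZ.nonneg a v
    unfold degOn at hz
    omega

/-- Removal of a leaf of `Z`. -/
theorem cherryGap_nonneg_of_leaf (hT : IsAdjacency T) (hZ : IsAdjacency Z)
    (hd : ∀ u v, T u v + Z u v ≤ 1) (ha : a ∈ W) {N r : ℤ} (hW : (W.card : ℤ) = N + 1)
    (hr : ∑ v ∈ W.erase a, degOn T (W.erase a) v = 2 * r)
    (hq : ∑ v ∈ W, degOn Z W v = 2 * (N - 2)) (hz : degOn Z W a = 1)
    (ih : 0 ≤ cherryGap T Z (W.erase a))
    (h : degOn T W a ≤ 1 ∨ degOn T W a + 3 ≤ N ∨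
      2 * r ≤ 2 * (degOn T W a - 2) * (N - 2) + 4 - degOn T W a * (degOn T W a - 1)) :
    0 ≤ cherryGap T Z W := by
  have hq' : ∑ v ∈ W.erase a, degOn Z (W.erase a) v = 2 * (N - 3) := by
    rw [sum_degOn_erase hZ ha, hz, hq]; ring
  rw [cherryGap_eq_erase hT hZ hd ha hW hr, hz]
  obtain ⟨y, hy, hay⟩ := exists_unique_neighbor hZ hz
  have hya : y ≠ a := fun h => by
    have := hay a ha; rw [hZ.irrefl, h] at this; simp at this
  have hyW : y ∈ W.erase a := Finset.mem_erase.mpr ⟨hya, hy⟩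
  have hTy : T a y = 0 := by
    have h1 := hay y hy
    have h2 := hd a y
    have h3 := hT.nonneg a y
    simp at h1; omega
  have hle : ∀ v ∈ W, T a v + Z a v ≤ 1 := fun v _ => hd a v
  set Δ := degOn T W a with hΔ
  have hΔ0 : 0 ≤ Δ := hT.degOn_nonneg a
  have b1 : 2 * (∑ v ∈ W.erase a, Z a v * degOn T (W.erase a) v
      + ∑ v ∈ W.erase a, T a v * (degOn T (W.erase a) v + degOn Z (W.erase a) v))
      ≤ 2 * (r + (N - 3)) + Δ * (Δ - 1) + 2 * Δ := by
    obtain ⟨k, hk⟩ := Int.even_mul_pred_self Δ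
    -- A T-edge has weight 2 only if both ends are neighbours of `a` in T ∪ Z, a Z-edge only if both
    -- ends are T-neighbours. The excess is thus bounded by the pairs of T-neighbours, `k` in
    -- number, and the Δ pairs joining `y` to a T-neighbour.
    have h := sum_mul_degOn_add_le hT hZ (fun v => Z a v + T a v) (fun v => T a v)
      (fun u v => (T a u * T a v - if v = u then T a u else 0)
        + (T a u * Z a v + Z a u * T a v)) (B := k + Δ) hr hq'
      (fun u hu v hv => by
        by_cases huv : v = u
        · have := mul_nonneg (hT.nonneg a u) (hZ.nonneg a u)
          simp [huv, hT.irrefl, hZ.irrefl, hT.sq, mul_comm (Z a u), this]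
        · have h3 := hd u v
          simp only [huv, if_false, hay u (Finset.mem_of_mem_erase hu),
            hay v (Finset.mem_of_mem_erase hv)]
          rcases hT.zero_or_one u v with h1 | h1 <;> rcases hZ.zero_or_one u v with h2 | h2 <;>
            rcases hT.zero_or_one a u with h4 | h4 <;> rcases hT.zero_or_one a v with h5 | h5 <;>
            simp only [h1, h2, h4, h5] at h3 ⊢ <;> split_ifs <;> subst_vars <;> simp_all)
      (by
        simp only [Finset.sum_add_distrib]
        rw [sum_offDiag_mul hT ha, ← Finset.sum_mul_sum, ← Finset.sum_mul_sum,
          sum_adj_erase hT ha, sum_adj_erase hZ ha, hz, ← hΔ, hk]; ring)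
    simp only [mul_add, add_mul, Finset.sum_add_distrib] at h ⊢
    linarith
  rcases hΔ0.eq_or_lt with h0 | h0
  · have hTa : ∀ v ∈ W.erase a, T a v = 0 := fun v hv =>
      (Finset.sum_eq_zero_iff_of_nonneg fun v _ => hT.nonneg a v).mp
        ((sum_adj_erase hT ha).trans h0.symm) v hv
    have h1 : ∑ v ∈ W.erase a, T a v * (degOn T (W.erase a) v + degOn Z (W.erase a) v) = 0 :=
      Finset.sum_eq_zero fun v hv => by rw [hTa v hv, zero_mul]
    have h2 : ∑ v ∈ W.erase a, Z a v * degOn T (W.erase a) v ≤ r := by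
      rw [Finset.sum_congr rfl fun v hv => by rw [hay v (Finset.mem_of_mem_erase hv)]]
      simp only [ite_mul, one_mul, zero_mul, Finset.sum_ite_eq', hyW, if_true]
      rw [← Finset.add_sum_erase _ _ hyW] at hr
      have h3 : degOn T (W.erase a) y ≤ ∑ v ∈ (W.erase a).erase y, degOn T (W.erase a) v := by
        rw [← degOn_erase_self hT hyW]
        refine Finset.sum_le_sum fun v hv => ?_
        rw [hT.symm]
        exact Finset.single_le_sum (fun u _ => hT.nonneg v u) hyW
      linarith
    rw [h1, ← h0]
    linarith
  by_cases hc : Δ = 1 ∨ Δ + 3 ≤ N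
  · have : 0 ≤ (Δ - 1) * (N - 3 - Δ) := by
      rcases hc with h | h
      · simp [h]
      · exact mul_nonneg (by omega) (by omega)
    nlinarith
  · have h3 : 2 * r ≤ 2 * (Δ - 2) * (N - 2) + 4 - Δ * (Δ - 1) := by
      rcases h with h | h | h <;> omega
    -- For Δ close to N few T-edges remain, and it is enough to count each remaining degree at most
    -- once.
    have h1 : ∑ v ∈ W.erase a, Z a v * degOn T (W.erase a) v
        + ∑ v ∈ W.erase a, T a v * degOn T (W.erase a) v ≤ 2 * r := by
      rw [← hr, ← Finset.sum_add_distrib]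
      refine Finset.sum_le_sum fun v _ => ?_
      rw [← add_mul]
      refine mul_le_of_le_one_left (hT.degOn_nonneg v) ?_
      linarith [hd a v]
    have h2 : ∑ v ∈ W.erase a, T a v * degOn Z (W.erase a) v ≤ 2 * (N - 3) := by
      rw [← hq']
      exact Finset.sum_le_sum fun v _ => mul_le_of_le_one_left (hZ.degOn_nonneg v) (hT.le_one a v)
    simp only [mul_add, Finset.sum_add_distrib]
    linarith

end

/-! ### Graphs `Z` without leaves: deleting an isolated vertex and an edge -/

/-- The graph obtained from `Z` by deleting the edge `xy`. -/
def deleteEdge {α : Type*} [DecidableEq α] (Z : α → α → ℤ) (x y u v : α) : ℤ :=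
  Z u v - (if u = x then 1 else 0) * (if v = y then 1 else 0)
    - (if u = y then 1 else 0) * (if v = x then 1 else 0)

section

variable {α : Type*} [DecidableEq α] {T Z : α → α → ℤ} {W : Finset α} {a x y : α}

theorem deleteEdge_le (u v : α) : deleteEdge Z x y u v ≤ Z u v := by
  unfold deleteEdge; split_ifs <;> omega

theorem IsAdjacency.deleteEdge (hZ : IsAdjacency Z) (hxy : Z x y = 1) :
    IsAdjacency (deleteEdge Z x y) where
  symm u v := by simp only [_root_.deleteEdge, hZ.symm u v]; ring
  irrefl u := by
    have := hZ.ne_of_adj hxy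
    simp only [_root_.deleteEdge, hZ.irrefl]
    split_ifs <;> simp_all
  zero_or_one u v := by
    have h1 := hZ.ne_of_adj hxy
    have h2 := hZ.symm x y
    have h3 := hZ.zero_or_one u v
    unfold _root_.deleteEdge
    split_ifs <;> subst_vars <;> simp_all

theorem degOn_deleteEdge (hx : x ∈ W) (hy : y ∈ W) (v : α) :
    degOn (deleteEdge Z x y) W v
      = degOn Z W v - (if v = x then 1 else 0) - (if v = y then 1 else 0) := by
  simp [degOn, deleteEdge, Finset.sum_sub_distrib, hx, hy]

theorem sum_degOn_deleteEdge (hx : x ∈ W) (hy : y ∈ W) :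
    ∑ v ∈ W, degOn (deleteEdge Z x y) W v = ∑ v ∈ W, degOn Z W v - 2 := by
  simp only [degOn_deleteEdge hx hy, Finset.sum_sub_distrib, Finset.sum_ite_eq', hx, hy, if_true]
  ring

/-- The price of dropping xy from Z: the induction hypothesis for the smaller Z overstates the gap
by this amount, so x and y should have small T-degree. -/
theorem cherryGap_deleteEdge (hx : x ∈ W) (hy : y ∈ W) :
    cherryGap T (deleteEdge Z x y) W
      = cherryGap T Z W + 2 * (degOn T W x + degOn T W y) := by
  have h : 2 * (degOn T W x + degOn T W y) = ∑ v ∈ W, 2 * degOn T W v *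
      ((if v = x then 1 else 0) + (if v = y then 1 else 0)) := by
    simp [mul_add, Finset.sum_add_distrib, hx, hy]
  rw [h, cherryGap, cherryGap, ← Finset.sum_add_distrib]
  refine Finset.sum_congr rfl fun v _ => ?_
  rw [degOn_deleteEdge hx hy]; ring

/-- The degree sum over `A` counts once the edges leaving `A` and twice those inside, so it exceeds
the number of edges by at most the number inside. -/
theorem two_mul_sum_degOn_le (hT : IsAdjacency T) {A : Finset α} (hA : A ⊆ W) {m : ℤ}
    (hm : ∑ v ∈ W, degOn T W v = 2 * m) :
    2 * ∑ v ∈ A, degOn T W v ≤ 2 * m + ∑ v ∈ A, degOn T A v := by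
  have h1 : ∑ v ∈ A, degOn T W v = ∑ v ∈ A, degOn T (W \ A) v + ∑ v ∈ A, degOn T A v := by
    rw [← Finset.sum_add_distrib]
    exact Finset.sum_congr rfl fun v _ => (Finset.sum_sdiff hA).symm
  have h2 : ∑ v ∈ A, degOn T (W \ A) v ≤ ∑ v ∈ W \ A, degOn T W v := by
    unfold degOn
    rw [Finset.sum_comm]
    refine Finset.sum_le_sum fun v _ => ?_
    rw [Finset.sum_congr rfl fun u _ => hT.symm u v]
    exact Finset.sum_le_sum_of_subset_of_nonneg hA fun u _ _ => hT.nonneg v u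
  have h3 := Finset.sum_sdiff (f := degOn T W) hA
  linarith

/-- A graph without leaves contains a path with three edges or a triangle `u = x`. -/
theorem exists_walk_of_no_leaf (hZ : IsAdjacency Z) {q : ℤ} (hq : ∑ v ∈ W, degOn Z W v = 2 * q)
    (hq0 : 0 < q) (hleaf : ∀ v ∈ W, degOn Z W v ≠ 1) :
    ∃ u ∈ W, ∃ v ∈ W, ∃ w ∈ W, ∃ x ∈ W,
      Z u v = 1 ∧ Z v w = 1 ∧ Z w x = 1 ∧ u ≠ w ∧ v ≠ x := by
  have step : ∀ u ∈ W, ∀ v ∈ W, Z u v = 1 → ∃ w ∈ W, Z v w = 1 ∧ u ≠ w := by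
    intro u hu v hv huv
    by_contra! h
    refine hleaf v hv ?_
    rw [degOn_eq_add_erase hu, hZ.symm, huv]
    have : degOn Z (W.erase u) v = 0 := Finset.sum_eq_zero fun w hw =>
      (hZ.zero_or_one v w).resolve_right fun h1 =>
        Finset.ne_of_mem_erase hw (h w (Finset.mem_of_mem_erase hw) h1).symm
    rw [this, add_zero]
  obtain ⟨u, hu, v, hv, huv⟩ : ∃ u ∈ W, ∃ v ∈ W, Z u v = 1 := by
    by_contra! h
    have : ∑ v ∈ W, degOn Z W v = 0 := Finset.sum_eq_zero fun u hu => Finset.sum_eq_zero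
      fun v hv => (hZ.zero_or_one u v).resolve_right (h u hu v hv)
    omega
  obtain ⟨w, hw, hvw, huw⟩ := step u hu v hv huv
  obtain ⟨x, hx, hwx, hvx⟩ := step v hv w hw hvw
  exact ⟨u, hu, v, hv, w, hw, x, hx, huv, hvw, hwx, huw, hvx⟩

theorem exists_edge_avoiding (hZ : IsAdjacency Z) {q : ℤ} (hq : ∑ v ∈ W, degOn Z W v = 2 * q)
    (hq0 : 0 < q) (hleaf : ∀ v ∈ W, degOn Z W v ≠ 1) (p : α) :
    ∃ x ∈ W, ∃ y ∈ W, Z x y = 1 ∧ x ≠ p ∧ y ≠ p := by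
  obtain ⟨u, hu, v, hv, w, hw, x, hx, huv, hvw, hwx, huw, hvx⟩ :=
    exists_walk_of_no_leaf hZ hq hq0 hleaf
  have h1 := hZ.ne_of_adj huv
  have h2 := hZ.ne_of_adj hvw
  have h3 := hZ.ne_of_adj hwx
  by_cases hpu : u = p
  · by_cases hpx : x = p
    · exact ⟨v, hv, w, hw, hvw, fun h => h1 (hpu.trans h.symm), fun h => huw (hpu.trans h.symm)⟩
    · exact ⟨w, hw, x, hx, hwx, fun h => huw (hpu.trans h.symm), hpx⟩
  · by_cases hpv : v = p
    · exact ⟨w, hw, x, hx, hwx, fun h => h2 (hpv.trans h.symm), fun h => hvx (hpv.trans h.symm)⟩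
    · exact ⟨u, hu, v, hv, huv, hpu, hpv⟩

/-- Suppose all Z-edges have T-degree sum at least K + 1. On a Z-triangle, which contains no T-edge,
adding the three sums contradicts `hK1`. On a Z-path with three edges, its two end edges are
disjoint and at most three T-edges lie within its four vertices, which contradicts `hK2`. -/
theorem exists_edge_degOn_add_le (hT : IsAdjacency T) (hZ : IsAdjacency Z)
    (hd : ∀ u v, T u v + Z u v ≤ 1) {q m K : ℤ} (hm : ∑ v ∈ W, degOn T W v = 2 * m)
    (hq : ∑ v ∈ W, degOn Z W v = 2 * q) (hq0 : 0 < q) (hleaf : ∀ v ∈ W, degOn Z W v ≠ 1)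
    (hK1 : 2 * m < 3 * (K + 1)) (hK2 : m + 3 < 2 * (K + 1)) :
    ∃ x ∈ W, ∃ y ∈ W, Z x y = 1 ∧ degOn T W x + degOn T W y ≤ K := by
  obtain ⟨u, hu, v, hv, w, hw, x, hx, huv, hvw, hwx, huw, hvx⟩ :=
    exists_walk_of_no_leaf hZ hq hq0 hleaf
  have h1 := hZ.ne_of_adj huv
  have h2 := hZ.ne_of_adj hvw
  have h3 := hZ.ne_of_adj hwx
  have noT : ∀ b c, Z b c = 1 → T b c = 0 := fun b c h => by
    have := hd b c; have := hT.nonneg b c; omega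
  have e1 := noT _ _ huv
  have e2 := noT _ _ hvw
  have e3 := noT _ _ hwx
  have s1 := hT.symm v u
  have s2 := hT.symm w v
  have s3 := hT.symm x w
  by_contra! hc
  have c1 := hc u hu v hv huv
  have c2 := hc v hv w hw hvw
  have c3 := hc w hw x hx hwx
  by_cases hxu : x = u
  · subst hxu
    have h := two_mul_sum_degOn_le hT (A := {x, v, w}) (by simp [Finset.insert_subset_iff, hx, hv, hw]) hm
    simp only [degOn, Finset.sum_insert, Finset.mem_insert, Finset.mem_singleton, h1, huw, h2,
      or_self, not_false_eq_true, Finset.sum_singleton] at h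
    simp only [hT.irrefl, s1, s2, ← s3, e1, e2] at h
    unfold degOn at c1 c2 c3
    omega
  · have h := two_mul_sum_degOn_le hT (A := {u, v, w, x})
      (by simp [Finset.insert_subset_iff, hu, hx, hv, hw]) hm
    have hux : u ≠ x := Ne.symm hxu
    simp only [degOn, Finset.sum_insert, Finset.mem_insert, Finset.mem_singleton, h1, huw, h2,
      hvx, h3, hux, or_self, not_false_eq_true, Finset.sum_singleton] at h
    simp only [hT.irrefl, s1, s2, s3, e1, e2, e3, hT.symm w u, hT.symm x u, hT.symm x v] at h
    have l1 := hT.le_one u w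
    have l2 := hT.le_one u x
    have l3 := hT.le_one v x
    unfold degOn at c1 c2 c3
    omega

/-- Removal of an isolated vertex of `Z`, with an edge `xy` moved out of `Z`. -/
theorem cherryGap_nonneg_of_isolated (hT : IsAdjacency T) (hZ : IsAdjacency Z)
    (hd : ∀ u v, T u v + Z u v ≤ 1) (ha : a ∈ W) {N r : ℤ} (hW : (W.card : ℤ) = N + 1)
    (hr : ∑ v ∈ W.erase a, degOn T (W.erase a) v = 2 * r) (hz : degOn Z W a = 0)
    (hx : x ∈ W.erase a) (hy : y ∈ W.erase a)
    (ih : 0 ≤ cherryGap T (deleteEdge Z x y) (W.erase a))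
    (h : 2 * (degOn T (W.erase a) x + degOn T (W.erase a) y)
      + 2 * ∑ v ∈ W.erase a, T a v * (degOn T (W.erase a) v + degOn Z (W.erase a) v)
      + degOn T W a * (degOn T W a - 1) ≤ 2 * r + 2 * (degOn T W a * (N - 1))) :
    0 ≤ cherryGap T Z W := by
  rw [cherryGap_deleteEdge hx hy] at ih
  have h1 : ∑ v ∈ W.erase a, Z a v * degOn T (W.erase a) v = 0 :=
    Finset.sum_eq_zero fun v hv => by
      rw [(Finset.sum_eq_zero_iff_of_nonneg fun v _ => hZ.nonneg a v).mp hz v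
        (Finset.mem_of_mem_erase hv), zero_mul]
  rw [cherryGap_eq_erase hT hZ hd ha hW hr, h1, hz]
  linarith

/-- The choice of the dropped edge depends on the T-degree Δ of the isolated vertex: any edge for Δ
= 0, an edge avoiding its T-neighbour for Δ = 1, and an edge with T-degree sum at most N - 2 for Δ ≥
2. -/
theorem cherryGap_nonneg_of_no_leaf (hT : IsAdjacency T) (hZ : IsAdjacency Z)
    (hd : ∀ u v, T u v + Z u v ≤ 1) {N m : ℤ} (hW : (W.card : ℤ) = N + 1) (hN : 6 ≤ N)
    (hm : ∑ v ∈ W, degOn T W v = 2 * m) (hq : ∑ v ∈ W, degOn Z W v = 2 * (N - 2))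
    (hm1 : m ≤ N + 1) (hm2 : m ≤ 2 * N - 6) (hleaf : ∀ v ∈ W, degOn Z W v ≠ 1)
    (ih : ∀ a ∈ W, ∀ Z' : α → α → ℤ, IsAdjacency Z' → (∀ u v, T u v + Z' u v ≤ 1) →
      ∑ v ∈ W.erase a, degOn Z' (W.erase a) v = 2 * (N - 3) → 0 ≤ cherryGap T Z' (W.erase a)) :
    0 ≤ cherryGap T Z W := by
  -- Otherwise all Z-degrees are at least 2, but they sum to 2(N - 2) over N + 1 vertices.
  obtain ⟨a, ha, hz⟩ : ∃ a ∈ W, degOn Z W a = 0 := by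
    by_contra! h
    have h1 : ∑ v ∈ W, 2 ≤ ∑ v ∈ W, degOn Z W v := Finset.sum_le_sum fun v hv => by
      have := hleaf v hv; have := h v hv; have := hZ.degOn_nonneg (W := W) v; omega
    rw [hq, Finset.sum_const, nsmul_eq_mul, hW] at h1
    omega
  have hZa : ∀ v ∈ W, Z a v = 0 := (Finset.sum_eq_zero_iff_of_nonneg fun v _ => hZ.nonneg a v).mp hz
  have hne : ∀ x ∈ W, ∀ y ∈ W, Z x y = 1 → x ∈ W.erase a ∧ y ∈ W.erase a := fun x hx y hy h =>
    ⟨Finset.mem_erase.mpr ⟨fun e => by rw [e, hZa y hy] at h; omega, hx⟩,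
      Finset.mem_erase.mpr ⟨fun e => by rw [hZ.symm, e, hZa x hx] at h; omega, hy⟩⟩
  set Δ := degOn T W a with hΔ
  have hr : ∑ v ∈ W.erase a, degOn T (W.erase a) v = 2 * (m - Δ) := by
    rw [sum_degOn_erase hT ha, hm]; ring
  have hq' : ∑ v ∈ W.erase a, degOn Z (W.erase a) v = 2 * (N - 2) := by
    rw [sum_degOn_erase hZ ha, hq, hz]; ring
  have done : ∀ x ∈ W, ∀ y ∈ W, Z x y = 1 →
      2 * (degOn T (W.erase a) x + degOn T (W.erase a) y)
      + 2 * ∑ v ∈ W.erase a, T a v * (degOn T (W.erase a) v + degOn Z (W.erase a) v)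
      + Δ * (Δ - 1) ≤ 2 * (m - Δ) + 2 * (Δ * (N - 1)) → 0 ≤ cherryGap T Z W := by
    intro x hx y hy hxy h
    obtain ⟨hx', hy'⟩ := hne x hx y hy hxy
    refine cherryGap_nonneg_of_isolated hT hZ hd ha hW hr hz hx' hy'
      (ih a ha _ (hZ.deleteEdge hxy) (fun u v => ?_) ?_) h
    · have := hd u v; have := deleteEdge_le (Z := Z) (x := x) (y := y) u v; omega
    · rw [sum_degOn_deleteEdge hx' hy', hq']; ring
  have noT : ∀ b c, Z b c = 1 → T b c = 0 := fun b c h => by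
    have := hd b c; have := hT.nonneg b c; omega
  have hΔ0 : 0 ≤ Δ := hT.degOn_nonneg a
  have hΔN : Δ ≤ N := by have := hT.degOn_le ha; omega
  have hT' : ∀ v, degOn T (W.erase a) v ≤ degOn T W v := fun v => by
    rw [degOn_eq_add_erase ha]; linarith [hT.nonneg v a]
  rcases hΔ0.eq_or_lt with h0 | h0
  · obtain ⟨x, hx, y, hy, hxy, -⟩ := exists_edge_avoiding hZ hq (by omega) hleaf a
    refine done x hx y hy hxy ?_
    obtain ⟨hx', hy'⟩ := hne x hx y hy hxy
    have h1 := degOn_add_degOn_le hT hx' hy' (hZ.ne_of_adj hxy) hr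
    have h2 : ∑ v ∈ W.erase a, T a v * (degOn T (W.erase a) v + degOn Z (W.erase a) v) = 0 :=
      Finset.sum_eq_zero fun v hv => by
        rw [(Finset.sum_eq_zero_iff_of_nonneg fun v _ => hT.nonneg a v).mp h0.symm v
          (Finset.mem_of_mem_erase hv), zero_mul]
    rw [noT x y hxy] at h1
    rw [h2, ← h0] at *
    linarith
  rcases (show 1 ≤ Δ from h0).eq_or_lt with h1 | h1
  · obtain ⟨p, hp, hap⟩ := exists_unique_neighbor hT h1.symm
    obtain ⟨x, hx, y, hy, hxy, hxp, hyp⟩ := exists_edge_avoiding hZ hq (by omega) hleaf p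
    refine done x hx y hy hxy ?_
    obtain ⟨hx', hy'⟩ := hne x hx y hy hxy
    have hpa : p ∈ W.erase a := Finset.mem_erase.mpr ⟨fun e => by
      have := hap a ha; rw [hT.irrefl, e] at this; simp at this, hp⟩
    have h2 : ∑ v ∈ W.erase a, T a v * (degOn T (W.erase a) v + degOn Z (W.erase a) v)
        = degOn T (W.erase a) p + degOn Z (W.erase a) p := by
      rw [Finset.sum_congr rfl fun v hv => by rw [hap v (Finset.mem_of_mem_erase hv)]]
      simp [ite_mul, hpa]
    have hxy' := hZ.ne_of_adj hxy
    have h3 := two_mul_sum_degOn_le hT (A := {x, y, p})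
      (by simp only [Finset.insert_subset_iff, Finset.singleton_subset_iff, hx', hy', hpa, and_self]) hr
    simp only [Finset.sum_insert, Finset.mem_insert, Finset.mem_singleton, hxy', hxp, hyp,
      or_self, not_false_eq_true, Finset.sum_singleton] at h3
    have h4 : degOn T {x, y, p} x + (degOn T {x, y, p} y + degOn T {x, y, p} p) ≤ 4 := by
      simp only [degOn, Finset.sum_insert, Finset.mem_insert, Finset.mem_singleton, hxy', hxp, hyp,
        or_self, not_false_eq_true, Finset.sum_singleton, hT.irrefl, hT.symm y x, noT x y hxy]
      have := hT.le_one x p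
      have := hT.le_one y p
      have := hT.le_one p x
      have := hT.le_one p y
      omega
    -- As x is no leaf, it has Z-degree at least 2, which leaves at most N - 3 for p.
    have h5 := degOn_add_degOn_le hZ hp hx (Ne.symm hxp) hq
    have h6 := hZ.le_one p x
    have h7 : 2 ≤ degOn Z W x := by
      have h8 := Finset.single_le_sum (f := Z x) (fun u _ => hZ.nonneg x u) hy
      have h9 : degOn Z W x = ∑ u ∈ W, Z x u := rfl
      have h10 := hleaf x hx
      omega
    have h8 : degOn Z (W.erase a) p ≤ degOn Z W p := by
      rw [degOn_eq_add_erase ha]; linarith [hZ.nonneg p a]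
    rw [h2, ← h1]
    linarith
  obtain ⟨x, hx, y, hy, hxy, hxyN⟩ := exists_edge_degOn_add_le (K := N - 2) hT hZ hd hm hq
    (by omega) hleaf (by omega) (by omega)
  refine done x hx y hy hxy ?_
  have hx2 := hT' x
  have hy2 := hT' y
  rcases le_or_gt (Δ + 2) N with h2 | h2
  · have h3 := two_mul_sum_neighbor_degOn_le hT hZ hd ha hr hq'
    rw [← hΔ] at h3
    have : 0 ≤ (Δ - 2) * (N - 2 - Δ) := mul_nonneg (by omega) (by omega)
    linarith
  · have h3 : ∑ v ∈ W.erase a, T a v * degOn T (W.erase a) v ≤ 2 * (m - Δ) := by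
      rw [← hr]
      exact Finset.sum_le_sum fun v _ => mul_le_of_le_one_left (hT.degOn_nonneg v) (hT.le_one a v)
    have h4 : ∑ v ∈ W.erase a, T a v * degOn Z (W.erase a) v ≤ 2 * (N - 2) := by
      rw [← hq']
      exact Finset.sum_le_sum fun v _ => mul_le_of_le_one_left (hZ.degOn_nonneg v) (hT.le_one a v)
    simp only [mul_add, Finset.sum_add_distrib]
    rcases (show Δ = N - 1 ∨ Δ = N by omega) with h5 | h5 <;> rw [h5] at * <;> nlinarith

/-- At a leaf, Δ is at most N - 1; the two values N - 2 and N - 1 not covered by the main estimate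
are settled by the bounds on m. The bound 2N - 6 is stronger than N + 1 only for N = 6. -/
theorem cherryGap_nonneg_of_erase (hT : IsAdjacency T) (hZ : IsAdjacency Z)
    (hd : ∀ u v, T u v + Z u v ≤ 1) {N m : ℤ} (hW : (W.card : ℤ) = N + 1) (hN : 6 ≤ N)
    (hm : ∑ v ∈ W, degOn T W v = 2 * m) (hq : ∑ v ∈ W, degOn Z W v = 2 * (N - 2))
    (hm1 : m ≤ N + 1) (hm2 : m ≤ 2 * N - 6)
    (ih : ∀ a ∈ W, ∀ Z' : α → α → ℤ, IsAdjacency Z' → (∀ u v, T u v + Z' u v ≤ 1) →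
      ∑ v ∈ W.erase a, degOn Z' (W.erase a) v = 2 * (N - 3) → 0 ≤ cherryGap T Z' (W.erase a)) :
    0 ≤ cherryGap T Z W := by
  by_cases hleaf : ∀ v ∈ W, degOn Z W v ≠ 1
  · exact cherryGap_nonneg_of_no_leaf hT hZ hd hW hN hm hq hm1 hm2 hleaf ih
  push Not at hleaf
  obtain ⟨a, ha, hz⟩ := hleaf
  have hΔN : degOn T W a + degOn Z W a ≤ N := by
    have := (hT.add hZ hd).degOn_le ha
    rw [degOn_add] at this; omega
  refine cherryGap_nonneg_of_leaf hT hZ hd ha hW (r := m - degOn T W a)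
    (by rw [sum_degOn_erase hT ha, hm]; ring) hq hz
    (ih a ha Z hZ hd (by rw [sum_degOn_erase hZ ha, hz, hq]; ring)) ?_
  rcases le_or_gt (degOn T W a + 3) N with h | h
  · exact Or.inr (Or.inl h)
  · refine Or.inr (Or.inr ?_)
    rcases (show degOn T W a = N - 2 ∨ degOn T W a = N - 1 by omega) with h5 | h5 <;> rw [h5] <;>
      nlinarith

end

/-! ### Small cases, the induction, and the full range of `m` -/

section

variable {α : Type*} [DecidableEq α] {T Z : α → α → ℤ} {W : Finset α}

theorem card_erase_cast {a : α} (ha : a ∈ W) {N : ℤ} (hW : (W.card : ℤ) = N + 1) :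
    ((W.erase a).card : ℤ) = N := by
  rw [Finset.card_erase_of_mem ha]
  have := Finset.card_pos.mpr ⟨a, ha⟩
  omega

/-- The value m = 5 exceeds half of the available edges; it is needed when a vertex is deleted in
the case N = 5, m = 6. -/
theorem cherryGap_nonneg_four (hT : IsAdjacency T) (hZ : IsAdjacency Z)
    (hd : ∀ u v, T u v + Z u v ≤ 1) {m : ℤ} (hW : (W.card : ℤ) = 5)
    (hm : ∑ v ∈ W, degOn T W v = 2 * m) (hq : ∑ v ∈ W, degOn Z W v = 4) (hm5 : m ≤ 5) :
    0 ≤ cherryGap T Z W := by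
  rcases le_or_gt m 3 with h | h
  · exact cherryGap_nonneg_of_le_three hT hZ hd (N := 4) (by omega) hm (by omega) h
  · have h1 := deCaen_cherryGap hT hZ hd (N := 4) (q := 2) (by omega) hm (by omega)
    have h2 : ∑ v ∈ W, degOn Z W v ≤ ∑ v ∈ W, degOn Z W v ^ 2 :=
      Finset.sum_le_sum fun v _ => Int.le_self_sq _
    obtain ⟨k, hk⟩ := even_cherryGap (Z := Z) m hm
    rcases (show m = 4 ∨ m = 5 by omega) with h | h <;> subst h <;> omega

theorem cherryGap_nonneg_five (hT : IsAdjacency T) (hZ : IsAdjacency Z)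
    (hd : ∀ u v, T u v + Z u v ≤ 1) {m : ℤ} (hW : (W.card : ℤ) = 6)
    (hm : ∑ v ∈ W, degOn T W v = 2 * m) (hq : ∑ v ∈ W, degOn Z W v = 6) (hm6 : m ≤ 6) :
    0 ≤ cherryGap T Z W := by
  rcases le_or_gt m 3 with h | h
  · exact cherryGap_nonneg_of_le_three hT hZ hd (N := 5) (by omega) hm (by omega) h
  rcases hm6.lt_or_eq with h6 | rfl
  · refine cherryGap_nonneg_of_deCaen hT hZ hd (N := 5) (by omega) (by omega) hm (by omega) ?_
    rcases (show m = 4 ∨ m = 5 by omega) with h | h <;> subst h <;> norm_num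
  by_contra! hneg
  have h1 := deCaen_cherryGap hT hZ hd (N := 5) (q := 3) (by omega) hm (by omega)
  obtain ⟨k, hk⟩ := even_cherryGap (Z := Z) 6 hm
  have h2 : ∑ v ∈ W, (degOn Z W v - 1) ^ 2 = ∑ v ∈ W, degOn Z W v ^ 2 - 6 := by
    have : ∑ v ∈ W, (degOn Z W v - 1) ^ 2
        = ∑ v ∈ W, degOn Z W v ^ 2 - 2 * ∑ v ∈ W, degOn Z W v + ∑ v ∈ W, 1 := by
      rw [Finset.mul_sum, ← Finset.sum_sub_distrib, ← Finset.sum_add_distrib]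
      exact Finset.sum_congr rfl fun v _ => by ring
    rw [this, hq, Finset.sum_const, nsmul_eq_mul, hW]; ring
  -- A gap of at most -2 forces equality here, so Z is a perfect matching and every vertex is a leaf
  -- of Z.
  have h3 : ∑ v ∈ W, (degOn Z W v - 1) ^ 2 = 0 :=
    le_antisymm (by omega) (Finset.sum_nonneg fun v _ => sq_nonneg _)
  have h4 : ∀ v ∈ W, degOn Z W v = 1 := fun v hv => by
    have := (Finset.sum_eq_zero_iff_of_nonneg fun v _ => sq_nonneg _).mp h3 v hv
    have := pow_eq_zero_iff (two_ne_zero) |>.mp this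
    omega
  by_cases hex : ∃ a ∈ W, degOn T W a = 1 ∨ degOn T W a = 2 ∨ degOn T W a = 4
  · obtain ⟨a, ha, hta⟩ := hex
    have hr : ∑ v ∈ W.erase a, degOn T (W.erase a) v = 2 * (6 - degOn T W a) := by
      rw [sum_degOn_erase hT ha, hm]; ring
    refine hneg.not_ge (cherryGap_nonneg_of_leaf hT hZ hd ha (N := 5) (by omega) hr (by omega)
      (h4 a ha) (cherryGap_nonneg_four hT hZ hd (card_erase_cast ha (by omega)) hr
        (by rw [sum_degOn_erase hZ ha, hq, h4 a ha]; rfl) (by omega)) ?_)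
    rcases hta with h | h | h <;> simp [h]
  -- Only the T-degrees 0 and 3 remain, and for both the vertex term t(5 - 2 - t) vanishes.
  · push Not at hex
    refine hneg.not_ge (Finset.sum_nonneg fun v hv => ?_)
    have h5 := (hT.add hZ hd).degOn_le hv
    rw [degOn_add, h4 v hv, hW] at h5
    have h6 := hT.degOn_nonneg (W := W) v
    have h7 := hex v hv
    rw [h4 v hv, hW]
    rcases (show degOn T W v = 0 ∨ degOn T W v = 3 by omega) with h | h <;> simp [h]

theorem cherryGap_nonneg_six (hT : IsAdjacency T) (hZ : IsAdjacency Z)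
    (hd : ∀ u v, T u v + Z u v ≤ 1) {m : ℤ} (hW : (W.card : ℤ) = 7)
    (hm : ∑ v ∈ W, degOn T W v = 2 * m) (hq : ∑ v ∈ W, degOn Z W v = 8) (hm8 : m ≤ 8) :
    0 ≤ cherryGap T Z W := by
  have hr : ∀ a ∈ W, ∑ v ∈ W.erase a, degOn T (W.erase a) v = 2 * (m - degOn T W a) :=
    fun a ha => by rw [sum_degOn_erase hT ha, hm]; ring
  have hnn := fun a => hT.degOn_nonneg (W := W) a
  rcases le_or_gt m 6 with h | h
  · refine cherryGap_nonneg_of_erase hT hZ hd (N := 6) (by omega) (by omega) hm (by omega)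
      (by omega) (by omega) fun a ha Z' hZ' hd' hq' => ?_
    have := hnn a
    exact cherryGap_nonneg_five hT hZ' hd' (card_erase_cast ha (by omega)) (hr a ha)
      (by omega) (by omega)
  rcases (show m = 7 ∨ m = 8 by omega) with rfl | rfl
  · exact cherryGap_nonneg_of_deCaen hT hZ hd (N := 6) (by omega) (by omega) hm (by omega)
      (by norm_num)
  by_contra! hneg
  have h1 := deCaen_cherryGap hT hZ hd (N := 6) (q := 4) (by omega) hm (by omega)
  obtain ⟨k, hk⟩ := even_cherryGap (Z := Z) 8 hm
  have h2 : ∑ v ∈ W, (degOn Z W v - 1) * (degOn Z W v - 2)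
      = ∑ v ∈ W, degOn Z W v ^ 2 - 10 := by
    have : ∑ v ∈ W, (degOn Z W v - 1) * (degOn Z W v - 2)
        = ∑ v ∈ W, degOn Z W v ^ 2 - 3 * ∑ v ∈ W, degOn Z W v + ∑ v ∈ W, 2 := by
      rw [Finset.mul_sum, ← Finset.sum_sub_distrib, ← Finset.sum_add_distrib]
      exact Finset.sum_congr rfl fun v _ => by ring
    rw [this, hq, Finset.sum_const, nsmul_eq_mul, hW]; ring
  have hnn2 : ∀ v ∈ W, 0 ≤ (degOn Z W v - 1) * (degOn Z W v - 2) := fun v _ => by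
    rcases le_or_gt (degOn Z W v) 1 with h | h
    · exact mul_nonneg_of_nonpos_of_nonpos (by omega) (by omega)
    · exact mul_nonneg (by omega) (by omega)
  have h3 : ∑ v ∈ W, (degOn Z W v - 1) * (degOn Z W v - 2) = 0 :=
    le_antisymm (by omega) (Finset.sum_nonneg hnn2)
  have h4 : ∀ v ∈ W, degOn Z W v = 1 ∨ degOn Z W v = 2 := fun v hv => by
    rcases mul_eq_zero.mp ((Finset.sum_eq_zero_iff_of_nonneg hnn2).mp h3 v hv) with h | h <;> omega
  have hle : ∀ v ∈ W, degOn T W v + degOn Z W v ≤ 6 := fun v hv => by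
    have h5 := (hT.add hZ hd).degOn_le hv
    rw [degOn_add, hW] at h5
    omega
  -- Otherwise t ≤ 3z - 2 at every vertex, with z = 1 or 2, so the T-degrees sum to at most 24 - 14
  -- = 10 instead of 16. The T-degree must be at least 2 so that five or fewer T-edges do not
  -- suffice to block the case N = 5, which allows six.
  obtain ⟨a, ha, hz, hta⟩ : ∃ a ∈ W, degOn Z W a = 1 ∧ 2 ≤ degOn T W a := by
    by_contra! hc
    have h5 : ∑ v ∈ W, degOn T W v ≤ ∑ v ∈ W, (3 * degOn Z W v - 2) :=
      Finset.sum_le_sum fun v hv => by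
        have := hc v hv; have := hle v hv; have := h4 v hv; omega
    rw [Finset.sum_sub_distrib, ← Finset.mul_sum, hq, hm, Finset.sum_const, nsmul_eq_mul, hW] at h5
    omega
  have h5 := hle a ha
  refine hneg.not_ge (cherryGap_nonneg_of_leaf hT hZ hd ha (N := 6) (by omega) (hr a ha) (by omega)
    hz (cherryGap_nonneg_five hT hZ hd (card_erase_cast ha (by omega)) (hr a ha)
      (by rw [sum_degOn_erase hZ ha, hq, hz]; rfl) (by omega)) ?_)
  rcases (show degOn T W a + 3 ≤ 6 ∨ degOn T W a = 4 ∨ degOn T W a = 5 by omega) with h | h | h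
  · exact Or.inr (Or.inl h)
  all_goals simp [h]

/-- The cherry gap is nonnegative if `Z` has `N - 2` and `T` at most `N + 2` edges. -/
theorem cherryGap_nonneg (hT : IsAdjacency T) (N : ℕ) (hN : 6 ≤ N) :
    ∀ (Z : α → α → ℤ) (W : Finset α) (m : ℤ), IsAdjacency Z → (∀ u v, T u v + Z u v ≤ 1) →
      (W.card : ℤ) = N + 1 → ∑ v ∈ W, degOn T W v = 2 * m →
      ∑ v ∈ W, degOn Z W v = 2 * ((N : ℤ) - 2) → m ≤ N + 2 → 0 ≤ cherryGap T Z W := by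
  induction N, hN using Nat.le_induction with
  | base =>
    intro Z W m hZ hd hW hm hq hm8
    exact cherryGap_nonneg_six hT hZ hd (by simpa using hW) hm (by simpa using hq) (by simpa using hm8)
  | succ N hN ih =>
    intro Z W m hZ hd hW hm hq hmN
    push_cast at hW hq hmN
    rcases (show m ≤ N + 2 ∨ m = N + 3 by omega) with h | h
    · refine cherryGap_nonneg_of_erase hT hZ hd hW (by omega) hm hq (by omega) (by omega)
        fun a ha Z' hZ' hd' hq' => ?_
      have := hT.degOn_nonneg (W := W) a
      exact ih Z' _ (m - degOn T W a) hZ' hd' (card_erase_cast ha hW)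
        (by rw [sum_degOn_erase hT ha, hm]; ring) (by rw [hq']; ring) (by omega)
    · refine cherryGap_nonneg_of_deCaen hT hZ hd hW (by omega) hm hq ?_
      have h6 : (6 : ℤ) ≤ N := by exact_mod_cast hN
      subst h
      nlinarith [mul_nonneg (show (0:ℤ) ≤ N by omega) (show (0 : ℤ) ≤ N - 6 by omega),
        mul_nonneg (mul_nonneg (show (0:ℤ) ≤ N by omega) (show (0:ℤ) ≤ N by omega))
          (show (0 : ℤ) ≤ N - 6 by omega)]

/-- The cherry gap is nonnegative if `T` has at most as many edges as the complement of `T ∪ Z`. -/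
theorem cherryGap_nonneg_of_le_half (hT : IsAdjacency T) (hZ : IsAdjacency Z)
    (hd : ∀ u v, T u v + Z u v ≤ 1) {N : ℕ} {m : ℤ} (hW : (W.card : ℤ) = N + 1) (hN : 2 ≤ N)
    (hm : ∑ v ∈ W, degOn T W v = 2 * m) (hq : ∑ v ∈ W, degOn Z W v = 2 * ((N : ℤ) - 2))
    (hhalf : 4 * m ≤ N * (N + 1) - 2 * (N - 2)) : 0 ≤ cherryGap T Z W := by
  rcases le_or_gt m 3 with h | h3
  · exact cherryGap_nonneg_of_le_three hT hZ hd hW hm hq h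
  rcases lt_or_ge N 6 with h6 | h6
  · interval_cases N
    · norm_num at hhalf; omega
    · norm_num at hhalf; omega
    · norm_num at hhalf hq hW
      exact cherryGap_nonneg_four hT hZ hd hW hm hq (by omega)
    · norm_num at hhalf hq hW
      exact cherryGap_nonneg_five hT hZ hd hW hm hq (by omega)
  rcases le_or_gt m (N + 2) with h | h
  · exact cherryGap_nonneg hT N h6 Z W m hZ hd hW hm hq h
  have h7 : (7 : ℤ) ≤ N := by
    by_contra! h7
    obtain rfl : N = 6 := by omega
    norm_num at hhalf h
    omega
  refine cherryGap_nonneg_of_deCaen hT hZ hd hW (by omega) hm hq ?_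
  have hN9 : N = 7 ∨ N = 8 ∨ (9 : ℤ) ≤ N := by omega
  rcases hN9 with rfl | rfl | h9
  · norm_num at *
    obtain rfl | rfl : m = 10 ∨ m = 11 := by omega
    all_goals norm_num
  · norm_num at *
    obtain ⟨k, rfl⟩ : ∃ k, m = 11 + k := ⟨m - 11, by ring⟩
    have h1 : 0 ≤ k * (4 - k) := mul_nonneg (by omega) (by omega)
    nlinarith
  · generalize (N : ℤ) = n at *
    -- With x = m + n - 2, the product is f(x) - f(2n) for the concave f(x) = x(n(n + 1) - 2x). Thus
    -- m is compared with the threshold m = n + 2, where the required inequality amounts to n > 6;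
    -- the second factor is nonnegative because n ≥ 9.
    have h1 : 0 ≤ (m - n - 2) * (n ^ 2 - 3 * n - 2 * (m + n - 2)) :=
      mul_nonneg (by linarith) (by nlinarith)
    nlinarith [mul_pos (show 0 < n by omega) (show 0 < n - 6 by omega)]

end

/-! ### From edge partitions to adjacency functions -/

theorem sum_ite_mem_eq_edgeSetDegree {n : ℕ} {A : Finset (Sym2 (Fin n))} (v : Fin n) :
    degOn (fun u v => if s(u, v) ∈ A then 1 else 0) Finset.univ v = (edgeSetDegree A v : ℤ) := by
  rw [degOn, Finset.sum_boole, edgeSetDegree]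
  congr 1
  refine Finset.card_bij (fun u _ => s(v, u)) (fun u hu => ?_) (fun u _ w _ h => ?_) fun e he => ?_
  · simpa using hu
  · simpa using Sym2.congr_right.mp h
  · obtain ⟨he, hv⟩ := Finset.mem_filter.mp he
    obtain ⟨u, rfl⟩ := hv
    exact ⟨u, by simpa using he, rfl⟩

theorem isAdjacency_of_edges {n : ℕ} {A : Finset (Sym2 (Fin n))} (hA : ∀ v, s(v, v) ∉ A) :
    IsAdjacency fun u v : Fin n => if s(u, v) ∈ A then 1 else 0 where
  symm u v := by rw [Sym2.eq_swap]
  irrefl u := if_neg (hA u)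
  zero_or_one u v := by by_cases h : s(u, v) ∈ A <;> simp [h]

theorem sum_edgeSetDegree {n : ℕ} {A : Finset (Sym2 (Fin n))} (hA : ∀ v, s(v, v) ∉ A) :
    ∑ v, edgeSetDegree A v = 2 * A.card := by
  simp only [edgeSetDegree, Finset.card_filter]
  rw [Finset.sum_comm, mul_comm, Finset.card_eq_sum_ones, Finset.sum_mul]
  refine Finset.sum_congr rfl fun e he => ?_
  induction e with
  | _ x y =>
    have hxy : x ≠ y := fun h => hA x (by rwa [← h] at he)
    rw [one_mul, ← Finset.card_filter, ← Finset.card_pair hxy]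
    congr 1
    ext v
    simp

theorem IsEdgePartition.swap {n : ℕ} {S T Z : Finset (Sym2 (Fin n))} (h : IsEdgePartition S T Z) :
    IsEdgePartition T S Z where
  disjoint_ST := h.disjoint_ST.symm
  disjoint_SZ := h.disjoint_TZ
  disjoint_TZ := h.disjoint_SZ
  union_eq := by rw [Finset.union_comm T S, h.union_eq]

theorem IsEdgePartition.mem_iff {n : ℕ} {S T Z : Finset (Sym2 (Fin n))}
    (h : IsEdgePartition S T Z) (u v : Fin n) :
    s(u, v) ∈ S ∨ s(u, v) ∈ T ∨ s(u, v) ∈ Z ↔ u ≠ v := by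
  have := congrArg (s(u, v) ∈ ·) h.union_eq
  simpa [or_assoc] using this

theorem IsEdgePartition.degree_sum {n : ℕ} {S T Z : Finset (Sym2 (Fin n))}
    (h : IsEdgePartition S T Z) (v : Fin n) :
    (edgeSetDegree S v + edgeSetDegree T v + edgeSetDegree Z v : ℤ) = n - 1 := by
  simp only [← sum_ite_mem_eq_edgeSetDegree, degOn, ← Finset.sum_add_distrib]
  have h1 : ∑ u, (1 - if u = v then (1 : ℤ) else 0) = n - 1 := by
    simp [Finset.sum_sub_distrib]
  rw [← h1]
  refine Finset.sum_congr rfl fun u _ => ?_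
  have h2 := h.mem_iff v u
  have h3 : s(v, u) ∈ S → s(v, u) ∉ T := fun a b => Finset.disjoint_left.mp h.disjoint_ST a b
  have h4 : s(v, u) ∈ S → s(v, u) ∉ Z := fun a b => Finset.disjoint_left.mp h.disjoint_SZ a b
  have h5 : s(v, u) ∈ T → s(v, u) ∉ Z := fun a b => Finset.disjoint_left.mp h.disjoint_TZ a b
  rw [ne_comm] at h2
  split_ifs <;> simp_all

/-- Substituting s = n - 1 - t - z turns the difference of the two sums into `cherryGap`, and |T| ≤
|S| becomes the half-size hypothesis on m. -/
theorem IsEdgePartition.sum_mul_le {n : ℕ} {S T Z : Finset (Sym2 (Fin n))}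
    (h : IsEdgePartition S T Z) (hZ : (Z.card : ℤ) = n - 3) (hle : T.card ≤ S.card) :
    ∑ i, edgeSetDegree Z i * edgeSetDegree T i ≤ ∑ i, edgeSetDegree S i * edgeSetDegree T i := by
  have loop : ∀ v, s(v, v) ∉ S ∧ s(v, v) ∉ T ∧ s(v, v) ∉ Z := fun v => by
    have := h.mem_iff v v; tauto
  obtain ⟨N, rfl⟩ : ∃ N, n = N + 1 := ⟨n - 1, by omega⟩
  push_cast at hZ
  have hST : (2 * (S.card + T.card + Z.card) : ℤ) = (N + 1) * N := by
    have h1 : ∀ A : Finset (Sym2 (Fin (N + 1))), (∀ v, s(v, v) ∉ A) →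
        (2 * A.card : ℤ) = ∑ v, (edgeSetDegree A v : ℤ) := fun A hA => by
      exact_mod_cast (sum_edgeSetDegree hA).symm
    rw [mul_add, mul_add, h1 S fun v => (loop v).1, h1 T fun v => (loop v).2.1,
      h1 Z fun v => (loop v).2.2, ← Finset.sum_add_distrib, ← Finset.sum_add_distrib,
      Finset.sum_congr rfl fun v _ => h.degree_sum v]
    simp
  have key := cherryGap_nonneg_of_le_half (W := Finset.univ) (N := N) (m := T.card)
    (isAdjacency_of_edges fun v => (loop v).2.1) (isAdjacency_of_edges fun v => (loop v).2.2)
    (fun u v => by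
      have : s(u, v) ∈ T → s(u, v) ∉ Z := fun a b => Finset.disjoint_left.mp h.disjoint_TZ a b
      split_ifs <;> simp_all)
    (by simp) (by omega)
    (by simp only [sum_ite_mem_eq_edgeSetDegree]
        exact_mod_cast sum_edgeSetDegree fun v => (loop v).2.1)
    (by simp only [sum_ite_mem_eq_edgeSetDegree]
        have : (N : ℤ) - 2 = Z.card := by omega
        rw [this]
        exact_mod_cast sum_edgeSetDegree fun v => (loop v).2.2)
    (by zify at hle; linarith)
  simp only [cherryGap, sum_ite_mem_eq_edgeSetDegree] at key
  zify
  rw [← sub_nonneg, ← Finset.sum_sub_distrib]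
  refine key.trans_eq (Finset.sum_congr rfl fun v _ => ?_)
  have h1 := h.degree_sum v
  rw [Finset.card_univ, Fintype.card_fin, ← h1]
  ring

theorem mainTheorem1 (n : ℕ) (S T Z : Finset (Sym2 (Fin n)))
    (hpart : IsEdgePartition S T Z) (hZ : (Z.card : ℤ) = (n : ℤ) - 3) :
    min (∑ i : Fin n, edgeSetDegree Z i * edgeSetDegree T i)
        (∑ i : Fin n, edgeSetDegree Z i * edgeSetDegree S i)
      ≤ ∑ i : Fin n, edgeSetDegree S i * edgeSetDegree T i := by
  rcases le_total T.card S.card with h | h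
  · exact (min_le_left _ _).trans (hpart.sum_mul_le hZ h)
  · refine (min_le_right _ _).trans ((hpart.swap.sum_mul_le hZ h).trans_eq ?_)
    exact Finset.sum_congr rfl fun i _ => mul_comm _ _
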